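/- **Proposition 2.2 (second description of $\mu^u$).** Let $p$ be an odd prime, let $u\ge 0$ be an integer, and let $\mathbb A$ be the set of isomorphism classes of finite abelian $p$-groups (with one representative chosen in each class), equipped with the $\sigma$-algebra of all subsets. For an integer $v\ge 0$, let $\mu^v$ be the Cohen–Lenstra measure on $\mathbb A$, given by $$\mu^v(A)=\frac{1}{|A|^v\,|\operatorname{Aut}(A)|}\prod_{k=1}^{\infty}\left(1-p^{-k-v}\right)\qquad(A\in\mathbb A).$$ Then $\mu^0$ is a probability measure, and the following holds. Choose a random group $G\in\mathbb A$ according to $\mu^0$ and then, given $G$, choose elements $g_1,\dots,g_u\in G$ independently and uniformly at random. Then the isomorphism class of $G/\langle g_1,\dots,g_u\rangle$ is distributed according to $\mu^u$; that is, the law of $G/\langle g_1,\dots,g_u\rangle$ on $\mathbb A$ equals $\mu^u$. -/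

import Mathlib

open MeasureTheory ProbabilityTheory

noncomputable section

namespace CohenLenstra

/-- A finite abelian `p`-group (written multiplicatively). -/
structure FinAbPGroup (p : ℕ) : Type 1 where
  carrier : Type
  [commGroup : CommGroup carrier]
  [finite : Finite carrier]
  isPGroup : IsPGroup p carrier

namespace FinAbPGroup

variable {p : ℕ}

instance : CoeSort (FinAbPGroup p) Type := ⟨FinAbPGroup.carrier⟩

instance (G : FinAbPGroup p) : CommGroup G := G.commGroup

instance (G : FinAbPGroup p) : Finite G := G.finite

/-- Every subset of a finite group is an event. -/
instance (G : FinAbPGroup p) : MeasurableSpace G := ⊤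

instance (G : FinAbPGroup p) : DiscreteMeasurableSpace G := ⟨fun _ => trivial⟩

/-- The quotient of a finite abelian `p`-group by a subgroup. -/
def quotient (G : FinAbPGroup p) (H : Subgroup G) : FinAbPGroup p where
  carrier := G ⧸ H
  isPGroup := G.isPGroup.to_quotient H

/-- Two groups are equivalent when they are isomorphic. -/
instance isoSetoid (p : ℕ) : Setoid (FinAbPGroup p) where
  r G H := Nonempty (G ≃* H)
  iseqv :=
    { refl := fun G => ⟨MulEquiv.refl G⟩
      symm := fun ⟨e⟩ => ⟨e.symm⟩
      trans := fun ⟨e⟩ ⟨f⟩ => ⟨e.trans f⟩ }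

end FinAbPGroup

/-- The set of isomorphism classes of finite abelian `p`-groups. -/
def IsoClass (p : ℕ) : Type 1 := Quotient (FinAbPGroup.isoSetoid p)

variable {p : ℕ}

/-- The isomorphism class of a finite abelian `p`-group. -/
def isoClass (G : FinAbPGroup p) : IsoClass p := Quotient.mk _ G

/-- The chosen representative of an isomorphism class. -/
def IsoClass.rep (A : IsoClass p) : FinAbPGroup p := Quotient.out A

theorem isoClass_rep (A : IsoClass p) : isoClass A.rep = A := Quotient.out_eq A

/-- Two groups have the same class exactly when they are isomorphic. -/
theorem isoClass_eq_iff (G H : FinAbPGroup p) : isoClass G = isoClass H ↔ Nonempty (G ≃* H) :=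
  Quotient.eq

/-- The σ-algebra on isomorphism classes is the full power set. -/
instance : MeasurableSpace (IsoClass p) := ⊤

instance : DiscreteMeasurableSpace (IsoClass p) := ⟨fun _ => trivial⟩

/-- The mass `|A|⁻ᵘ |Aut A|⁻¹ ∏_{k ≥ 1} (1 - p^{-k-u})` of the class of `A`;
the index `k` of the product below is shifted by one. -/
def weight (u : ℕ) (A : IsoClass p) : ℝ :=
  1 / ((Nat.card A.rep : ℝ) ^ u * (Nat.card (MulAut A.rep) : ℝ)) *
    ∏' k : ℕ, (1 - 1 / (p : ℝ) ^ (k + 1 + u))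

/-- The Cohen–Lenstra measure `μᵘ` on isomorphism classes of finite abelian `p`-groups. -/
def clMeasure (p u : ℕ) : Measure (IsoClass p) :=
  Measure.sum fun A => ENNReal.ofReal (weight u A) • Measure.dirac A

/-- A group (the representative of its class) together with `u` elements of it. -/
abbrev Sample (p u : ℕ) : Type 1 := Σ A : IsoClass p, (Fin u → A.rep)

/-- The joint law of `(G, g₁, …, g_u)`: draw `G` from `μ⁰`; given `G`, the elements `g_i` are
independent and uniform on `G`. -/
def sampleMeasure (p u : ℕ) : Measure (Sample p u) :=
  (clMeasure p 0).bind fun A =>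
    (Measure.pi fun _ : Fin u => uniformOn (Set.univ : Set A.rep)).map (Sigma.mk A)

/-- The isomorphism class of `G / ⟨g₁, …, g_u⟩`. -/
def sampleQuotient (p u : ℕ) (x : Sample p u) : IsoClass p :=
  isoClass (x.1.rep.quotient (Subgroup.closure (Set.range x.2)))

/-- The infinite product in `weight` converges. -/
theorem multipliable_weight (hp : 1 < p) (u : ℕ) :
    Multipliable fun k : ℕ => (1 - 1 / (p : ℝ) ^ (k + 1 + u)) := by
  have hp' : (1 : ℝ) < p := by exact_mod_cast hp
  have hs : Summable fun k : ℕ => -(1 / (p : ℝ) ^ (k + 1 + u)) := by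
    have h := (summable_geometric_of_lt_one (r := 1 / (p : ℝ)) (by positivity)
      ((div_lt_one (by linarith)).2 hp')).mul_right (-(1 / (p : ℝ)) ^ (1 + u))
    refine h.congr fun k => ?_
    rw [add_assoc, ← one_div_pow, pow_add _ k]
    ring
  simpa [sub_eq_add_neg] using Real.multipliable_one_add_of_summable hs

theorem weight_nonneg (hp : 1 < p) (u : ℕ) (A : IsoClass p) : 0 ≤ weight u A := by
  have hp' : (1 : ℝ) < p := by exact_mod_cast hp
  refine mul_nonneg (by positivity) ?_
  refine ge_of_tendsto (multipliable_weight hp u).hasProd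
    (Filter.Eventually.of_forall fun s => Finset.prod_nonneg fun k _ => ?_)
  rw [sub_nonneg, div_le_one (by positivity)]
  exact one_le_pow₀ hp'.le

theorem clMeasure_singleton (u : ℕ) (A : IsoClass p) :
    clMeasure p u {A} = ENNReal.ofReal (weight u A) := by
  rw [clMeasure, Measure.sum_apply _ (MeasurableSet.singleton A), tsum_eq_single A]
  · simp
  · intro B hB
    simp [hB]

theorem measurable_sampleQuotient (p u : ℕ) : Measurable (sampleQuotient p u) := by
  intro s _
  refine MeasurableSpace.measurableSet_iInf.2 fun A => ?_
  change MeasurableSet (Sigma.mk A ⁻¹' (sampleQuotient p u ⁻¹' s))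
  exact MeasurableSet.of_discrete

end CohenLenstra

end

/-! Dividing by one uniform element sends the unnormalized mass `mass v` to a multiple of `mass (v +
1)`, and dividing by `u` elements iterates this.

The core is a mass formula (`tsum_card_elements_div`): for fixed `B` and `n = p ^ k`, the sum over
`A` of the number of `g` of order `n` in `A` with `A / ⟨g⟩ ≅ B`, divided by `|Aut A|`, is `1 / |Aut
B|`. Let `F` be free on the set `B`, with relations `R`. Such a `g`, together with a set-theoretic
lift to `A` of an isomorphism `B ≅ A / ⟨g⟩`, is a surjection `F × ℤ → A` whose kernel is an
extension kernel. There are `|Aut B| * n ^ |B|` lifts for each `g` and `|Aut A|` surjections for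
each kernel, and the kernels are the graphs of the `n ^ |B|` homomorphisms `R → ℤ/n`, as `R` is free
of rank `|B|`. Summing over `A` cancels `n ^ |B|`.

Since `|A| = p ^ k * |B|`, summing over `k` gives a geometric series, whence the factor `eulerFactor
p v` (`tsum_mass_mul_card_elements`). These factors account for the ratio of the normalizing
products of `μ⁰` and `μᵘ`.

The same recursion in `v` gives the total mass: as `v` grows, only the trivial group keeps its mass,
so the total of `mass 0` is the inverse of the infinite product. Finiteness is not known beforehand,
so the upper bound is proved for groups of order at most `N`. -/

noncomputable section

namespace CohenLenstra

/-! ### Counting tuples and surjections by fibres. -/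

section Counting

/-- A surjection of groups identifies its source with the product of target and kernel. -/
theorem exists_equiv_prod_ker {A A' : Type*} [AddGroup A] [AddGroup A'] (f : A →+ A')
    (hf : Function.Surjective f) : ∃ e : A ≃ A' × f.ker, ∀ a, (e a).1 = f a :=
  ⟨{  toFun := fun a => (f a, ⟨a - Function.surjInv hf (f a), by
        simp [AddMonoidHom.mem_ker, Function.surjInv_eq hf]⟩)
      invFun := fun x => x.2.1 + Function.surjInv hf x.1
      left_inv := fun a => by simp
      right_inv := fun x => by
        have h : f (x.2.1 + Function.surjInv hf x.1) = x.1 := by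
          rw [map_add, x.2.2, zero_add, Function.surjInv_eq hf]
        ext
        · exact h
        · simp [h] }, fun _ => rfl⟩

/-- The number of tuples in the source of a surjection whose image has a given property. -/
theorem card_tuples_comp {A A' ι : Type*} [AddGroup A] [AddGroup A'] [Finite ι]
    (f : A →+ A') (hf : Function.Surjective f) (Q : (ι → A') → Prop) :
    Nat.card {y : ι → A // Q (f ∘ y)} =
      Nat.card {y : ι → A' // Q y} * Nat.card f.ker ^ Nat.card ι := by
  obtain ⟨e, he⟩ := exists_equiv_prod_ker f hf
  let E : (ι → A) ≃ (ι → A') × (ι → f.ker) :=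
    (Equiv.arrowCongr (Equiv.refl ι) e).trans (Equiv.arrowProdEquivProdArrow ι _ _)
  have hE : ∀ y, (E y).1 = f ∘ y := fun y => funext fun i => he (y i)
  rw [← Nat.card_fun, ← Nat.card_prod]
  refine Nat.card_congr ((E.subtypeEquiv (q := fun x => Q x.1 ∧ True) fun y => ?_).trans
    (Equiv.subtypeProdEquivProd.trans
      (Equiv.prodCongr (Equiv.refl _) (Equiv.subtypeUnivEquiv fun _ => trivial))))
  rw [hE, and_true]

variable {P A : Type*} [AddCommGroup P] [AddCommGroup A]

/-- Surjections with a prescribed kernel are isomorphisms from the quotient. -/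
def surjectionEquiv (K : AddSubgroup P) :
    {φ : P →+ A // Function.Surjective φ ∧ φ.ker = K} ≃ (P ⧸ K ≃+ A) where
  toFun φ := (QuotientAddGroup.quotientAddEquivOfEq φ.2.2.symm).trans
    (QuotientAddGroup.quotientKerEquivOfSurjective φ.1 φ.2.1)
  invFun e := ⟨e.toAddMonoidHom.comp (QuotientAddGroup.mk' K),
    e.surjective.comp (QuotientAddGroup.mk'_surjective K), by
      ext x
      simp⟩
  left_inv φ := by
    ext x
    rfl
  right_inv e := by
    ext x
    obtain ⟨x, rfl⟩ := QuotientAddGroup.mk_surjective x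
    rfl

/-- Surjections onto `A` with kernel in a given family, counted by their kernels. -/
theorem card_surjections (Q : AddSubgroup P → Prop) :
    Nat.card {φ : P →+ A // Function.Surjective φ ∧ Q φ.ker} =
      Nat.card {K : {K // Q K} // Nonempty (P ⧸ K.1 ≃+ A)} * Nat.card (A ≃+ A) := by
  rw [← Nat.card_prod]
  let f : {φ : P →+ A // Function.Surjective φ ∧ Q φ.ker} →
      {K : {K // Q K} // Nonempty (P ⧸ K.1 ≃+ A)} := fun φ =>
    ⟨⟨φ.1.ker, φ.2.2⟩, ⟨QuotientAddGroup.quotientKerEquivOfSurjective φ.1 φ.2.1⟩⟩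
  refine Nat.card_congr ((Equiv.sigmaFiberEquiv f).symm.trans
    ((Equiv.sigmaCongrRight fun K => ?_).trans (Equiv.sigmaEquivProd _ _)))
  let E : {φ // f φ = K} ≃ {φ : P →+ A // Function.Surjective φ ∧ φ.ker = K.1.1} :=
    { toFun := fun φ => ⟨φ.1.1, φ.1.2.1, congrArg (fun K => K.1.1) φ.2⟩
      invFun := fun φ => ⟨⟨φ.1, φ.2.1, φ.2.2.symm ▸ K.1.2⟩, Subtype.ext (Subtype.ext φ.2.2)⟩
      left_inv := fun _ => rfl
      right_inv := fun _ => rfl }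
  -- One fixed isomorphism `P ⧸ K ≃+ A` turns all the others into automorphisms of `A`, so every
  -- fibre has the same size.
  let e := K.2.some
  exact (E.trans (surjectionEquiv K.1.1)).trans
    { toFun := fun e' => e.symm.trans e'
      invFun := fun e' => e.trans e'
      left_inv := fun e' => by ext; simp
      right_inv := fun e' => by ext; simp }

end Counting

/-! ### Extension kernels as homomorphisms from the relations of `B` to `ℤ/n`. -/

section Presentation

variable {B : Type*} [AddCommGroup B]

/-- The map from the free abelian group on `B` to `B`. -/
def freeToGroup (B : Type*) [AddCommGroup B] : (B →₀ ℤ) →ₗ[ℤ] B :=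
  Finsupp.linearCombination ℤ id

@[simp]
theorem freeToGroup_single (b : B) (z : ℤ) : freeToGroup B (Finsupp.single b z) = z • b := by
  simp [freeToGroup]

theorem freeToGroup_surjective : Function.Surjective (freeToGroup B) := fun b =>
  ⟨Finsupp.single b 1, by simp⟩

/-- The relations of `B` are a free abelian group of rank `|B|`. -/
theorem exists_basis_relations [Finite B] :
    Nonempty (Module.Basis B ℤ (LinearMap.ker (freeToGroup B))) := by
  have e := (freeToGroup B).quotKerEquivOfSurjective freeToGroup_surjective
  have : Finite ((B →₀ ℤ) ⧸ LinearMap.ker (freeToGroup B)) := Finite.of_equiv _ e.toEquiv.symm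
  -- A subgroup of finite index in a free abelian group of finite rank has full rank.
  have h := (Submodule.finiteQuotient_iff _).1 this
  have := Fintype.ofFinite B
  rw [Module.finrank_finsupp_self] at h
  exact ⟨(Module.finBasisOfFinrankEq ℤ _ h).reindex (Fintype.equivFin B).symm⟩

/-- The subgroups of `(B →₀ ℤ) × ℤ` whose quotient is an extension of `B` by a cyclic group of
order `n` generated by the image of `(0, 1)`. -/
def IsExtKernel (n : ℕ) (K : AddSubgroup ((B →₀ ℤ) × ℤ)) : Prop :=
  (∀ z : ℤ, (0, z) ∈ K ↔ (n : ℤ) ∣ z) ∧ ∀ f, (∃ z, (f, z) ∈ K) ↔ freeToGroup B f = 0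

/-- The graph of a homomorphism from the relations of `B` to `ℤ/n`. -/
def graphKernel {n : ℕ} (θ : LinearMap.ker (freeToGroup B) →ₗ[ℤ] ZMod n) :
    AddSubgroup ((B →₀ ℤ) × ℤ) where
  carrier := {x | ∃ h : x.1 ∈ LinearMap.ker (freeToGroup B), θ ⟨x.1, h⟩ = (x.2 : ZMod n)}
  zero_mem' := ⟨Submodule.zero_mem _, θ.map_zero.trans Int.cast_zero.symm⟩
  add_mem' := by
    rintro ⟨x, a⟩ ⟨y, b⟩ ⟨hx, h1⟩ ⟨hy, h2⟩
    refine ⟨Submodule.add_mem _ hx hy, ?_⟩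
    exact (θ.map_add ⟨x, hx⟩ ⟨y, hy⟩).trans ((congrArg₂ _ h1 h2).trans (Int.cast_add a b).symm)
  neg_mem' := by
    rintro ⟨x, a⟩ ⟨hx, h1⟩
    refine ⟨Submodule.neg_mem _ hx, ?_⟩
    exact (θ.map_neg ⟨x, hx⟩).trans ((congrArg _ h1).trans (Int.cast_neg a).symm)

theorem isExtKernel_graphKernel {n : ℕ} (θ : LinearMap.ker (freeToGroup B) →ₗ[ℤ] ZMod n) :
    IsExtKernel n (graphKernel θ) := by
  refine ⟨fun z => ?_, fun f => ⟨fun ⟨z, h, _⟩ => h, fun h => ?_⟩⟩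
  · rw [← ZMod.intCast_zmod_eq_zero_iff_dvd]
    constructor
    · rintro ⟨h, h'⟩
      exact h'.symm.trans θ.map_zero
    · intro h
      exact ⟨Submodule.zero_mem _, θ.map_zero.trans h.symm⟩
  · obtain ⟨z, hz⟩ := ZMod.intCast_surjective (θ ⟨f, h⟩)
    exact ⟨z, h, hz.symm⟩

theorem graphKernel_injective {n : ℕ} :
    Function.Injective (graphKernel (B := B) (n := n)) := by
  intro θ θ' h
  ext ⟨f, hf⟩
  obtain ⟨z, hz⟩ := ZMod.intCast_surjective (θ ⟨f, hf⟩)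
  have : (f, z) ∈ graphKernel θ' := h ▸ ⟨hf, hz.symm⟩
  obtain ⟨_, h'⟩ := this
  exact hz.symm.trans h'.symm

theorem exists_graphKernel {n : ℕ} {K : AddSubgroup ((B →₀ ℤ) × ℤ)} (hK : IsExtKernel n K) :
    ∃ θ : LinearMap.ker (freeToGroup B) →ₗ[ℤ] ZMod n, graphKernel θ = K := by
  choose z hz using fun f : LinearMap.ker (freeToGroup B) => (hK.2 f).2 f.2
  -- Two integers over the same relation differ by an element of `K ∩ ({0} × ℤ) = nℤ`, so the choice
  -- `z f` is canonical modulo `n`; this makes `θ` additive.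
  have key : ∀ (f : LinearMap.ker (freeToGroup B)) (a : ℤ),
      (f.1, a) ∈ K ↔ ((z f : ℤ) : ZMod n) = a := by
    intro f a
    rw [ZMod.intCast_eq_intCast_iff_dvd_sub, ← hK.1]
    constructor
    · intro h
      simpa using K.sub_mem h (hz f)
    · intro h
      simpa using K.add_mem h (hz f)
  let θ : LinearMap.ker (freeToGroup B) →+ ZMod n := AddMonoidHom.mk' (fun f => (z f : ZMod n))
    fun f g => by
      rw [← Int.cast_add, ← key]
      exact K.add_mem (hz f) (hz g)
  refine ⟨θ.toIntLinearMap, ?_⟩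
  ext ⟨f, a⟩
  constructor
  · rintro ⟨h, h'⟩
    exact (key ⟨f, h⟩ a).2 h'
  · intro h
    exact ⟨(hK.2 f).1 ⟨a, h⟩, (key ⟨f, _⟩ a).1 h⟩

/-- The family of extension kernels is in bijection with functions from `B` to `ℤ/n`. -/
theorem nonempty_extKernel_equiv [Finite B] (n : ℕ) :
    Nonempty ({K : AddSubgroup ((B →₀ ℤ) × ℤ) // IsExtKernel n K} ≃ (B → ZMod n)) := by
  obtain ⟨b⟩ := exists_basis_relations (B := B)
  refine ⟨((b.constr ℤ).toEquiv.trans (Equiv.ofBijective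
    (fun θ => ⟨graphKernel θ, isExtKernel_graphKernel θ⟩) ⟨fun θ θ' h => ?_, fun K => ?_⟩)).symm⟩
  · exact graphKernel_injective (Subtype.ext_iff.1 h)
  · obtain ⟨θ, hθ⟩ := exists_graphKernel K.2
    exact ⟨θ, Subtype.ext hθ⟩

end Presentation

/-! ### Cyclic extensions of `B` as surjections from `(B →₀ ℤ) × ℤ`. -/

section Extension

variable {A B : Type*} [AddCommGroup A]

/-- A homomorphism from `(B →₀ ℤ) × ℤ` is given by the images of the generators. -/
def homEquiv : A × (B → A) ≃ ((B →₀ ℤ) × ℤ →+ A) where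
  toFun x := (Finsupp.linearCombination ℤ x.2).toAddMonoidHom.coprod (zmultiplesHom A x.1)
  invFun φ := (φ (0, 1), fun b => φ (Finsupp.single b 1, 0))
  left_inv x := by ext <;> simp
  right_inv φ := by
    have h : Finsupp.linearCombination ℤ (fun b => φ (Finsupp.single b 1, 0)) =
        (φ.comp (AddMonoidHom.inl (B →₀ ℤ) ℤ)).toIntLinearMap := by
      ext
      simp
    refine AddMonoidHom.ext fun ⟨f, z⟩ => ?_
    have hf := DFunLike.congr_fun h f
    have hz : z • φ (0, 1) = φ (0, z) := by
      rw [← map_zsmul]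
      simp
    simp only [AddMonoidHom.coprod_apply, LinearMap.toAddMonoidHom_coe, zmultiplesHom_apply]
    rw [hf, hz]
    change φ (f, 0) + _ = _
    rw [← map_add]
    simp

theorem homEquiv_apply (x : A × (B → A)) (f : B →₀ ℤ) (z : ℤ) :
    homEquiv x (f, z) = Finsupp.linearCombination ℤ x.2 f + z • x.1 := by
  simp [homEquiv]

variable [AddCommGroup B]

/-- `x.1` has order `n`, and `x.2` lifts an isomorphism of `B` with `A / ⟨x.1⟩`. -/
def IsExtDatum (n : ℕ) (x : A × (B → A)) : Prop :=
  addOrderOf x.1 = n ∧ ∃ e : B ≃+ A ⧸ AddSubgroup.zmultiples x.1,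
    QuotientAddGroup.mk' (AddSubgroup.zmultiples x.1) ∘ x.2 = e

/-- The map `ψ` below sends the generator `b` to the class of `s b` modulo `⟨g⟩`. The factor `ℤ`
covers exactly `⟨g⟩`, so `homEquiv (g, s)` is onto iff `ψ` is. The second kernel condition says that
`ψ` has the same kernel as `freeToGroup B`. Both together mean that `ψ` descends to an isomorphism
from `B`. -/
theorem isExtKernel_iff (n : ℕ) (x : A × (B → A)) :
    (Function.Surjective (homEquiv x) ∧ IsExtKernel n (homEquiv x).ker) ↔ IsExtDatum n x := by
  obtain ⟨g, s⟩ := x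
  have h1 : (∀ z : ℤ, (0, z) ∈ (homEquiv (g, s)).ker ↔ (n : ℤ) ∣ z) ↔ addOrderOf g = n := by
    simp only [AddMonoidHom.mem_ker, homEquiv_apply, map_zero, zero_add,
      ← addOrderOf_dvd_iff_zsmul_eq_zero]
    constructor
    · intro h
      refine Nat.dvd_antisymm ?_ ?_
      · exact Int.natCast_dvd_natCast.1 ((h n).2 dvd_rfl)
      · exact Int.natCast_dvd_natCast.1 ((h _).1 dvd_rfl)
    · rintro rfl z
      rfl
  have h2 : ∀ f, (∃ z, (f, z) ∈ (homEquiv (g, s)).ker) ↔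
      Finsupp.linearCombination ℤ s f ∈ AddSubgroup.zmultiples g := by
    intro f
    simp only [AddMonoidHom.mem_ker, homEquiv_apply, AddSubgroup.mem_zmultiples_iff]
    constructor
    · rintro ⟨z, hz⟩
      exact ⟨-z, by rw [neg_smul, neg_eq_of_add_eq_zero_left hz]⟩
    · rintro ⟨z, hz⟩
      exact ⟨-z, by rw [neg_smul, ← hz, add_neg_cancel]⟩
  let π := QuotientAddGroup.mk' (AddSubgroup.zmultiples g)
  have hπ : ∀ a, π a = 0 ↔ a ∈ AddSubgroup.zmultiples g := fun a =>
    QuotientAddGroup.eq_zero_iff a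
  let ψ : (B →₀ ℤ) →+ A ⧸ AddSubgroup.zmultiples g :=
    π.comp (Finsupp.linearCombination ℤ s).toAddMonoidHom
  unfold IsExtKernel IsExtDatum
  rw [h1]
  simp only [h2]
  constructor
  · rintro ⟨hs, hn, hk⟩
    refine ⟨hn, ?_⟩
    have hψ : Function.Surjective ψ := by
      intro q
      obtain ⟨a, rfl⟩ := QuotientAddGroup.mk'_surjective _ q
      obtain ⟨⟨f, z⟩, rfl⟩ := hs a
      refine ⟨f, ?_⟩
      rw [homEquiv_apply, map_add]
      change _ = _ + π _
      rw [(hπ _).2 ⟨z, rfl⟩, add_zero]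
      rfl
    have hker : ψ.ker = (freeToGroup B).toAddMonoidHom.ker := by
      ext f
      exact (hπ _).trans (hk f)
    let e := ((QuotientAddGroup.quotientKerEquivOfSurjective _
      (freeToGroup_surjective (B := B))).symm.trans
        (QuotientAddGroup.quotientAddEquivOfEq hker.symm)).trans
        (QuotientAddGroup.quotientKerEquivOfSurjective ψ hψ)
    refine ⟨e, funext fun b => ?_⟩
    have he : (QuotientAddGroup.quotientKerEquivOfSurjective (freeToGroup B).toAddMonoidHom
      (freeToGroup_surjective (B := B))).symm b = QuotientAddGroup.mk (Finsupp.single b 1) := by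
      rw [AddEquiv.symm_apply_eq]
      change _ = freeToGroup B _
      simp
    change _ = QuotientAddGroup.quotientKerEquivOfSurjective ψ hψ
      (QuotientAddGroup.quotientAddEquivOfEq hker.symm
        ((QuotientAddGroup.quotientKerEquivOfSurjective (freeToGroup B).toAddMonoidHom
      (freeToGroup_surjective (B := B))).symm b))
    rw [he]
    change _ = ψ _
    simp [ψ, π]
  · rintro ⟨hn, e, he⟩
    have hψ : ∀ f, ψ f = e (freeToGroup B f) := by
      intro f
      have : ψ = e.toAddMonoidHom.comp (freeToGroup B).toAddMonoidHom := by
        ext b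
        simpa [ψ, π] using congrFun he b
      exact DFunLike.congr_fun this f
    refine ⟨fun a => ?_, hn, fun f => ?_⟩
    · obtain ⟨f, hf⟩ := freeToGroup_surjective (e.symm (π a))
      have : π (a - Finsupp.linearCombination ℤ s f) = 0 := by
        rw [map_sub, sub_eq_zero]
        change _ = ψ f
        rw [hψ, hf, e.apply_symm_apply]
      obtain ⟨z, hz⟩ := (hπ _).1 this
      refine ⟨(f, z), ?_⟩
      rw [homEquiv_apply]
      change z • g = _ at hz
      simp [hz]
    · rw [← hπ]
      change ψ f = 0 ↔ _
      rw [hψ, map_eq_zero_iff e e.injective]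

/-- Over a fixed `g` the isomorphisms `B ≅ A / ⟨g⟩` form a torsor under `Aut B`, and each lifts
pointwise in `n ^ |B|` ways, the lifts being arbitrary functions. -/
theorem card_isExtDatum [Finite A] [Finite B] (n : ℕ) :
    Nat.card {x : A × (B → A) // IsExtDatum n x} =
      Nat.card {g : A // addOrderOf g = n ∧ Nonempty (A ⧸ AddSubgroup.zmultiples g ≃+ B)} *
        (Nat.card (B ≃+ B) * n ^ Nat.card B) := by
  let G := {g : A // addOrderOf g = n ∧ Nonempty (A ⧸ AddSubgroup.zmultiples g ≃+ B)}
  let S : G → Type _ := fun g => {s : B → A // ∃ e : B ≃+ A ⧸ AddSubgroup.zmultiples g.1,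
    QuotientAddGroup.mk' (AddSubgroup.zmultiples g.1) ∘ s = e}
  have E : {x : A × (B → A) // IsExtDatum n x} ≃ Σ g : G, S g :=
    { toFun := fun x => ⟨⟨x.1.1, x.2.1, ⟨x.2.2.choose.symm⟩⟩, x.1.2, x.2.2⟩
      invFun := fun y => ⟨(y.1.1, y.2.1), y.1.2.1, y.2.2⟩
      left_inv := fun _ => rfl
      right_inv := fun _ => rfl }
  have hS : ∀ g, Nat.card (S g) = Nat.card (B ≃+ B) * n ^ Nat.card B := by
    rintro ⟨g, rfl, ⟨e₀⟩⟩
    have h := card_tuples_comp (ι := B) (QuotientAddGroup.mk' (AddSubgroup.zmultiples g))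
      (QuotientAddGroup.mk'_surjective _)
      (fun y => ∃ e : B ≃+ A ⧸ AddSubgroup.zmultiples g, y = e)
    refine h.trans ?_
    rw [QuotientAddGroup.ker_mk', Nat.card_zmultiples]
    congr 1
    refine Nat.card_congr (Equiv.symm (Equiv.ofBijective
      (fun e : B ≃+ B => ⟨e.trans e₀.symm, e.trans e₀.symm, rfl⟩) ⟨fun e e' h => ?_, ?_⟩))
    · ext b
      have := congrFun (Subtype.ext_iff.1 h) b
      simpa using this
    · rintro ⟨_, e, rfl⟩
      refine ⟨e.trans e₀, Subtype.ext ?_⟩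
      ext b
      simp
  have := Fintype.ofFinite G
  have : ∀ g, Finite (S g) := fun g => inferInstance
  rw [Nat.card_congr E, Nat.card_sigma]
  simp [hS, G]

/-- The elements of order `n` with quotient `B`, counted by extension kernels. -/
theorem card_elements_mul [Finite A] [Finite B] (n : ℕ) :
    Nat.card {g : A // addOrderOf g = n ∧ Nonempty (A ⧸ AddSubgroup.zmultiples g ≃+ B)} *
        (Nat.card (B ≃+ B) * n ^ Nat.card B) =
      Nat.card {K : {K : AddSubgroup ((B →₀ ℤ) × ℤ) // IsExtKernel n K} //
        Nonempty (((B →₀ ℤ) × ℤ) ⧸ K.1 ≃+ A)} * Nat.card (A ≃+ A) := by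
  rw [← card_isExtDatum, ← card_surjections]
  exact Nat.card_congr (homEquiv.subtypeEquiv fun x => (isExtKernel_iff n x).symm)

/-- If `m` kills `B`, then `n * m` kills the quotient by an extension kernel. -/
theorem nsmul_eq_zero_of_isExtKernel {n m : ℕ} {K : AddSubgroup ((B →₀ ℤ) × ℤ)}
    (hK : IsExtKernel n K) (hB : ∀ b : B, m • b = 0) (x : ((B →₀ ℤ) × ℤ) ⧸ K) :
    (n * m) • x = 0 := by
  -- Since `m • f` is a relation, some `(m • f, a)` lies in `K`; then `nm (f, z) = n (m f, a) + (0,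
  -- n (m z - a))`.
  obtain ⟨⟨f, z⟩, rfl⟩ := QuotientAddGroup.mk_surjective x
  obtain ⟨a, ha⟩ := (hK.2 (m • f)).2 (by rw [map_nsmul, hB])
  rw [← QuotientAddGroup.mk_nsmul, QuotientAddGroup.eq_zero_iff]
  have h1 := K.nsmul_mem ha n
  have h2 := (hK.1 (n * (m * z - a))).2 ⟨_, rfl⟩
  convert K.add_mem h1 h2 using 1
  ext
  · simp [mul_smul]
  · simp
    ring

theorem finite_quotient_of_isExtKernel [Finite B] {n : ℕ} (hn : n ≠ 0)
    {K : AddSubgroup ((B →₀ ℤ) × ℤ)} (hK : IsExtKernel n K) :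
    Finite (((B →₀ ℤ) × ℤ) ⧸ K) := by
  have hfg : AddGroup.FG (((B →₀ ℤ) × ℤ) ⧸ K) := by
    have : AddGroup.FG ((B →₀ ℤ) × ℤ) := Module.Finite.iff_addGroup_fg.1 inferInstance
    infer_instance
  refine AddCommGroup.finite_of_fg_isAddTorsion _ fun x => ?_
  refine isOfFinAddOrder_iff_nsmul_eq_zero.2 ⟨n * Nat.card B,
    Nat.pos_of_ne_zero (mul_ne_zero hn Nat.card_pos.ne'), ?_⟩
  exact nsmul_eq_zero_of_isExtKernel hK (fun b => card_nsmul_eq_zero') x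

end Extension

/-! ### The mass formula for cyclic extensions. -/

open Filter Topology
open scoped ENNReal

/-- Summing a function of the fibre against fibre cardinalities. -/
theorem tsum_card_fiber_mul {X I : Type*} [Finite X] (c : X → I) (F : I → ℝ≥0∞) :
    ∑' i, (Nat.card {x // c x = i} : ℝ≥0∞) * F i = ∑' x, F (c x) := by
  classical
  have := Fintype.ofFinite X
  have h : ∀ i, (Nat.card {x // c x = i} : ℝ≥0∞) * F i = ∑' x, if c x = i then F i else 0 := by
    intro i
    rw [tsum_fintype, ← Finset.sum_filter, Finset.sum_const, nsmul_eq_mul,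
      Nat.card_eq_fintype_card, Fintype.card_subtype]
  simp_rw [h]
  rw [ENNReal.tsum_comm]
  refine tsum_congr fun x => ?_
  rw [tsum_eq_single (c x) fun i hi => if_neg hi.symm, if_pos rfl]

theorem tsum_const_finite {X : Type*} [Finite X] (a : ℝ≥0∞) :
    ∑' _ : X, a = Nat.card X * a := by
  have := Fintype.ofFinite X
  rw [tsum_fintype, Finset.sum_const, Finset.card_univ, ← Nat.card_eq_fintype_card, nsmul_eq_mul]

/-- A quotient is isomorphic to `B` exactly when its kernel is that of a surjection to `B`. -/
theorem nonempty_quotient_mulEquiv_iff {A B : Type*} [CommGroup A] [CommGroup B] (H : Subgroup A) :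
    Nonempty (A ⧸ H ≃* B) ↔ ∃ f : A →* B, Function.Surjective f ∧ f.ker = H := by
  constructor
  · rintro ⟨e⟩
    refine ⟨e.toMonoidHom.comp (QuotientGroup.mk' H),
      e.surjective.comp (QuotientGroup.mk'_surjective H), ?_⟩
    ext x
    simp
  · rintro ⟨f, hf, rfl⟩
    exact ⟨QuotientGroup.quotientKerEquivOfSurjective f hf⟩

/-- Comparing kernels of surjections avoids identifying the additive quotient with the
multiplicative one. -/
theorem nonempty_additive_quotient_iff {A B : Type*} [CommGroup A] [CommGroup B] (g : A) :
    Nonempty (Additive A ⧸ AddSubgroup.zmultiples (Additive.ofMul g) ≃+ Additive B) ↔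
      Nonempty (A ⧸ Subgroup.zpowers g ≃* B) := by
  rw [nonempty_quotient_mulEquiv_iff]
  constructor
  · rintro ⟨e⟩
    obtain ⟨φ, hφ, hk⟩ := (surjectionEquiv _).symm e
    refine ⟨MonoidHom.toAdditive.symm φ, hφ, ?_⟩
    ext x
    exact SetLike.ext_iff.1 hk (Additive.ofMul x)
  · rintro ⟨f, hf, hk⟩
    refine ⟨surjectionEquiv _ ⟨MonoidHom.toAdditive f, hf, ?_⟩⟩
    ext x
    exact SetLike.ext_iff.1 hk x.toMul

variable {p : ℕ}

theorem isoClass_quotient_eq_iff (G : FinAbPGroup p) (H : Subgroup G) (B : IsoClass p) :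
    isoClass (G.quotient H) = B ↔ Nonempty (G ⧸ H ≃* B.rep) := by
  conv_lhs => rw [← isoClass_rep B]
  exact isoClass_eq_iff _ _

theorem natCard_ne_zero (X : Type*) [Finite X] [Nonempty X] : (Nat.card X : ℝ≥0∞) ≠ 0 :=
  Nat.cast_ne_zero.2 Nat.card_pos.ne'

/-- The pairs `(A, g)` with `g` of order `p ^ k` and `A / ⟨g⟩ ≅ B`, counted up to isomorphism
with weights. -/
theorem tsum_card_elements_div (hp : p.Prime) (B : IsoClass p) (k : ℕ) :
    ∑' A : IsoClass p, (Nat.card {g : A.rep // orderOf g = p ^ k ∧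
      Nonempty (A.rep ⧸ Subgroup.zpowers g ≃* B.rep)} : ℝ≥0∞) / Nat.card (MulAut A.rep) =
      (Nat.card (MulAut B.rep) : ℝ≥0∞)⁻¹ := by
  have : NeZero (p ^ k) := ⟨pow_ne_zero _ hp.ne_zero⟩
  let B' := Additive B.rep
  let KK := {K : AddSubgroup ((B' →₀ ℤ) × ℤ) // IsExtKernel (p ^ k) K}
  obtain ⟨eK⟩ := nonempty_extKernel_equiv (B := B') (p ^ k)
  have : Finite KK := Finite.of_equiv _ eK.symm
  have hKK : Nat.card KK = (p ^ k) ^ Nat.card B' := by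
    rw [Nat.card_congr eK, Nat.card_fun, Nat.card_zmod]
  have hBp : ∃ m, Nat.card B.rep = p ^ m := by
    have := Fact.mk hp
    exact IsPGroup.iff_card.1 B.rep.isPGroup
  obtain ⟨m, hm⟩ := hBp
  have hB0 : ∀ b : B', p ^ m • b = 0 := fun b => by
    rw [← hm]
    exact card_nsmul_eq_zero' (G := B')
  have hfin : ∀ K : KK, Finite (((B' →₀ ℤ) × ℤ) ⧸ K.1) := fun K =>
    finite_quotient_of_isExtKernel (NeZero.ne (p ^ k)) K.2
  -- The quotient is a `p`-group because `p ^ k * p ^ m` kills it, where `|B| = p ^ m`.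
  let c : KK → IsoClass p := fun K => isoClass
    { carrier := Multiplicative (((B' →₀ ℤ) × ℤ) ⧸ K.1)
      finite := hfin K
      isPGroup := fun x => ⟨k + m, by
        have := nsmul_eq_zero_of_isExtKernel K.2 hB0 x.toAdd
        rw [← pow_add] at this
        exact this⟩ }
  have hc : ∀ K A, c K = A ↔ Nonempty (((B' →₀ ℤ) × ℤ) ⧸ K.1 ≃+ Additive A.rep) := by
    intro K A
    conv_lhs => rw [← isoClass_rep A]
    refine (isoClass_eq_iff _ _).trans ?_
    exact ⟨fun ⟨e⟩ => ⟨MulEquiv.toAdditive e⟩, fun ⟨e⟩ => ⟨MulEquiv.toAdditive.symm e⟩⟩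
  have key : ∀ A : IsoClass p, (Nat.card {g : A.rep // orderOf g = p ^ k ∧
      Nonempty (A.rep ⧸ Subgroup.zpowers g ≃* B.rep)} : ℝ≥0∞) / Nat.card (MulAut A.rep) =
      (Nat.card {K : KK // c K = A} : ℝ≥0∞) *
        ((Nat.card (MulAut B.rep) : ℝ≥0∞)⁻¹ * (Nat.card KK : ℝ≥0∞)⁻¹) := by
    intro A
    have h := card_elements_mul (A := Additive A.rep) (B := B') (p ^ k)
    have e1 : Nat.card {g : Additive A.rep // addOrderOf g = p ^ k ∧
        Nonempty (Additive A.rep ⧸ AddSubgroup.zmultiples g ≃+ B')} =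
        Nat.card {g : A.rep // orderOf g = p ^ k ∧
          Nonempty (A.rep ⧸ Subgroup.zpowers g ≃* B.rep)} :=
      Nat.card_congr (Additive.toMul.subtypeEquiv fun g =>
        and_congr (by rw [← addOrderOf_ofMul_eq_orderOf]; rfl)
          (nonempty_additive_quotient_iff g.toMul))
    have e2 : ∀ C : IsoClass p, Nat.card (Additive C.rep ≃+ Additive C.rep) =
        Nat.card (MulAut C.rep) := fun C => Nat.card_congr MulEquiv.toAdditive.symm
    have e3 : Nat.card {K : KK // Nonempty (((B' →₀ ℤ) × ℤ) ⧸ K.1 ≃+ Additive A.rep)} =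
        Nat.card {K : KK // c K = A} :=
      Nat.card_congr (Equiv.subtypeEquivRight fun K => (hc K A).symm)
    rw [e1, e2, e2, ← hKK, e3] at h
    have h' := congrArg (Nat.cast (R := ℝ≥0∞)) h
    push_cast at h'
    have : Nonempty KK := ⟨eK.symm 0⟩
    have a1 := natCard_ne_zero (MulAut A.rep)
    have a2 := natCard_ne_zero (MulAut B.rep)
    have a3 := natCard_ne_zero KK
    rw [← ENNReal.mul_inv (Or.inl a2) (Or.inr a3), ← div_eq_mul_inv,
      ENNReal.div_eq_div_iff (mul_ne_zero a2 a3) (by finiteness) a1 (by simp), mul_comm, h',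
      mul_comm]
  simp_rw [key]
  rw [tsum_card_fiber_mul c fun _ => (Nat.card (MulAut B.rep) : ℝ≥0∞)⁻¹ * (Nat.card KK : ℝ≥0∞)⁻¹]
  have : Nonempty KK := ⟨eK.symm 0⟩
  rw [tsum_const_finite, mul_left_comm, ENNReal.mul_inv_cancel (natCard_ne_zero KK) (by simp), mul_one]

/-! ### Dividing by one random element. -/

/-- The unnormalized mass `|A|⁻ᵛ |Aut A|⁻¹`. -/
def mass (v : ℕ) (A : IsoClass p) : ℝ≥0∞ :=
  ((Nat.card A.rep : ℝ≥0∞) ^ v * Nat.card (MulAut A.rep))⁻¹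

/-- The factor `(1 - p^{-(v + 1)})⁻¹`. -/
def eulerFactor (p v : ℕ) : ℝ≥0∞ := (1 - ((p : ℝ≥0∞) ^ (v + 1))⁻¹)⁻¹

theorem card_of_quotient_zpowers {A B : Type*} [CommGroup A] [CommGroup B] [Finite A]
    (g : A) (e : A ⧸ Subgroup.zpowers g ≃* B) : Nat.card A = orderOf g * Nat.card B := by
  rw [Subgroup.card_eq_card_quotient_mul_card_subgroup (Subgroup.zpowers g),
    Nat.card_congr e.toEquiv, Nat.card_zpowers, mul_comm]

/-- Split by the order `p ^ k` of `g`: then `|A| ^ (v + 1) = p ^ (k (v + 1)) * |B| ^ (v + 1)`, so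
`tsum_card_elements_div` applies for each `k` and a geometric series in `k` remains. -/
theorem tsum_mass_mul_card_elements (hp : p.Prime) (v : ℕ) (B : IsoClass p) :
    ∑' A : IsoClass p, mass v A * ((Nat.card A.rep : ℝ≥0∞)⁻¹ *
      Nat.card {g : A.rep // isoClass (A.rep.quotient (Subgroup.zpowers g)) = B}) =
      eulerFactor p v * mass (v + 1) B := by
  have := Fact.mk hp
  have key : ∀ A : IsoClass p, mass v A * ((Nat.card A.rep : ℝ≥0∞)⁻¹ *
      Nat.card {g : A.rep // isoClass (A.rep.quotient (Subgroup.zpowers g)) = B}) =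
      ∑' k : ℕ, ((((p : ℝ≥0∞) ^ (v + 1))⁻¹) ^ k * ((Nat.card B.rep : ℝ≥0∞) ^ (v + 1))⁻¹) *
        ((Nat.card {g : A.rep // orderOf g = p ^ k ∧
          Nonempty (A.rep ⧸ Subgroup.zpowers g ≃* B.rep)} : ℝ≥0∞) / Nat.card (MulAut A.rep)) := by
    intro A
    let X := {g : A.rep // isoClass (A.rep.quotient (Subgroup.zpowers g)) = B}
    have ho : ∀ g : A.rep, ∃ k, orderOf g = p ^ k := IsPGroup.iff_orderOf.1 A.rep.isPGroup
    choose κ hκ using ho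
    have h1 : (Nat.card X : ℝ≥0∞) =
        ∑' k : ℕ, (Nat.card {g : A.rep // orderOf g = p ^ k ∧
          Nonempty (A.rep ⧸ Subgroup.zpowers g ≃* B.rep)} : ℝ≥0∞) := by
      have h := tsum_card_fiber_mul (fun x : X => κ x.1) fun _ => 1
      rw [tsum_const_finite, mul_one] at h
      rw [← h]
      refine tsum_congr fun k => ?_
      rw [mul_one]
      congr 1
      refine Nat.card_congr ((Equiv.subtypeSubtypeEquivSubtypeInter
        (fun g : A.rep => isoClass (A.rep.quotient (Subgroup.zpowers g)) = B)
        (fun g => κ g = k)).trans (Equiv.subtypeEquivRight fun g => ?_))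
      rw [isoClass_quotient_eq_iff, hκ, (Nat.pow_right_injective hp.two_le).eq_iff, and_comm]
    change _ * (_ * (Nat.card X : ℝ≥0∞)) = _
    rw [h1, ← ENNReal.tsum_mul_left, ← ENNReal.tsum_mul_left]
    refine tsum_congr fun k => ?_
    -- The relation `|A| = p ^ k * |B|` is available only when such a `g` exists; otherwise both
    -- sides vanish.
    by_cases he : IsEmpty {g : A.rep // orderOf g = p ^ k ∧
          Nonempty (A.rep ⧸ Subgroup.zpowers g ≃* B.rep)}
    · simp
    · obtain ⟨g, hg, ⟨e⟩⟩ := not_isEmpty_iff.1 he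
      have hA := card_of_quotient_zpowers g e
      rw [hg] at hA
      have b1 := natCard_ne_zero B.rep
      have hA' : (Nat.card A.rep : ℝ≥0∞) = (p : ℝ≥0∞) ^ k * Nat.card B.rep := by
        exact_mod_cast hA
      have a1 := natCard_ne_zero A.rep
      have a2 := natCard_ne_zero (MulAut A.rep)
      have : mass v A * (Nat.card A.rep : ℝ≥0∞)⁻¹ =
          ((p : ℝ≥0∞) ^ (v + 1))⁻¹ ^ k * ((Nat.card B.rep : ℝ≥0∞) ^ (v + 1))⁻¹ *
            (Nat.card (MulAut A.rep) : ℝ≥0∞)⁻¹ := by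
        rw [mass, ENNReal.mul_inv (Or.inr (by simp)) (Or.inr a2), mul_right_comm,
          ← ENNReal.mul_inv (Or.inr (by simp)) (Or.inr a1), ← pow_succ, hA', mul_pow,
          ENNReal.mul_inv (Or.inr (by finiteness)) (Or.inr (pow_ne_zero _ b1)),
          ← ENNReal.inv_pow, ← pow_mul, ← pow_mul, mul_comm k]
      rw [← mul_assoc, this, div_eq_mul_inv]
      ring
  simp_rw [key]
  rw [ENNReal.tsum_comm]
  simp_rw [ENNReal.tsum_mul_left, tsum_card_elements_div hp B, ENNReal.tsum_mul_right,
    ENNReal.tsum_geometric]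
  rw [mass, ENNReal.mul_inv (Or.inr (by simp)) (Or.inr (natCard_ne_zero _)), eulerFactor, mul_assoc]

/-! ### Dividing by `u` random elements. -/

/-- Quotients by generated subgroups can be computed after dividing out one generator. -/
theorem nonempty_quotient_closure_cons {A A' : Type*} [CommGroup A] [CommGroup A'] {u : ℕ}
    {f : A →* A'} (hf : Function.Surjective f) {g : A} (hk : f.ker = Subgroup.zpowers g)
    (y : Fin u → A) :
    Nonempty (A ⧸ Subgroup.closure (Set.range (Fin.cons g y : Fin (u + 1) → A)) ≃*
      A' ⧸ Subgroup.closure (Set.range (f ∘ y))) := by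
  rw [nonempty_quotient_mulEquiv_iff]
  refine ⟨(QuotientGroup.mk' _).comp f, (QuotientGroup.mk'_surjective _).comp hf, ?_⟩
  -- The kernel of the composite is `f⁻¹⟨f ∘ y⟩ = ⟨y⟩ ⊔ ker f = ⟨y⟩ ⊔ ⟨g⟩`.
  rw [← MonoidHom.comap_ker, QuotientGroup.ker_mk', Set.range_comp, ← MonoidHom.map_closure,
    Subgroup.comap_map_eq, hk, Fin.range_cons, Set.insert_eq, Subgroup.closure_union,
    Subgroup.zpowers_eq_closure, sup_comm]

/-- The probability that `u` random elements of `A` generate a subgroup with quotient `B`. -/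
def quotientProb (u : ℕ) (A B : IsoClass p) : ℝ≥0∞ :=
  (Nat.card {y : Fin u → A.rep // sampleQuotient p u ⟨A, y⟩ = B} : ℝ≥0∞) /
    (Nat.card A.rep : ℝ≥0∞) ^ u

/-- The image of a uniform tuple in `A / ⟨g⟩` is again uniform: each tuple there has `(orderOf g) ^
u` lifts, which cancels against `|A| ^ u = (orderOf g * |A / ⟨g⟩|) ^ u`. -/
theorem card_cons_div (u : ℕ) (A B : IsoClass p) (g : A.rep) :
    (Nat.card {y : Fin u → A.rep // sampleQuotient p (u + 1) ⟨A, Fin.cons g y⟩ = B} : ℝ≥0∞) /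
      (Nat.card A.rep : ℝ≥0∞) ^ u =
      quotientProb u (isoClass (A.rep.quotient (Subgroup.zpowers g))) B := by
  set A' := isoClass (A.rep.quotient (Subgroup.zpowers g)) with hA'
  have hiso := (isoClass_quotient_eq_iff _ _ _).1 hA'.symm
  have hcard := card_of_quotient_zpowers g hiso.some
  obtain ⟨f, hf, hk⟩ := (nonempty_quotient_mulEquiv_iff _).1 hiso
  have h := card_tuples_comp (ι := Fin u) (MonoidHom.toAdditive f) hf
    fun y => sampleQuotient p u ⟨A', y⟩ = B
  have hker : Nat.card (MonoidHom.toAdditive f).ker = orderOf g := by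
    rw [← Nat.card_zpowers, ← hk]
    rfl
  have h1 : Nat.card {y : Fin u → A.rep // sampleQuotient p (u + 1) ⟨A, Fin.cons g y⟩ = B} =
      Nat.card {y : Fin u → A'.rep // sampleQuotient p u ⟨A', y⟩ = B} * orderOf g ^ u := by
    rw [hker, Nat.card_fin] at h
    refine Eq.trans (Nat.card_congr (Equiv.subtypeEquivRight fun y => ?_)) h
    have : sampleQuotient p (u + 1) ⟨A, Fin.cons g y⟩ = sampleQuotient p u ⟨A', f ∘ y⟩ :=
      (isoClass_eq_iff _ _).2 (nonempty_quotient_closure_cons hf hk y)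
    rw [this]
    rfl
  have ho : ((orderOf g : ℝ≥0∞)) ^ u ≠ 0 :=
    pow_ne_zero _ (Nat.cast_ne_zero.2 (orderOf_pos g).ne')
  rw [h1, hcard, quotientProb]
  push_cast
  rw [mul_pow, mul_comm ((orderOf g : ℝ≥0∞) ^ u), ENNReal.mul_div_mul_right _ _ ho (by finiteness)]

theorem quotientProb_succ (u : ℕ) (A B : IsoClass p) :
    quotientProb (u + 1) A B = (Nat.card A.rep : ℝ≥0∞)⁻¹ *
      ∑' g : A.rep, quotientProb u (isoClass (A.rep.quotient (Subgroup.zpowers g))) B := by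
  have E : {y : Fin (u + 1) → A.rep // sampleQuotient p (u + 1) ⟨A, y⟩ = B} ≃
      Σ g : A.rep, {y : Fin u → A.rep // sampleQuotient p (u + 1) ⟨A, Fin.cons g y⟩ = B} :=
    { toFun := fun y => ⟨y.1 0, Fin.tail y.1, by rw [Fin.cons_self_tail]; exact y.2⟩
      invFun := fun x => ⟨Fin.cons x.1 x.2.1, x.2.2⟩
      left_inv := fun y => Subtype.ext (Fin.cons_self_tail _)
      right_inv := fun x => rfl }
  have := Fintype.ofFinite A.rep
  simp_rw [← card_cons_div]
  rw [quotientProb, Nat.card_congr E, Nat.card_sigma, tsum_fintype]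
  push_cast
  simp_rw [div_eq_mul_inv]
  rw [← Finset.sum_mul, pow_succ, ENNReal.mul_inv (Or.inr (by simp))
    (Or.inr (natCard_ne_zero _))]
  ring

theorem quotientProb_zero (A B : IsoClass p) [Decidable (A = B)] :
    quotientProb 0 A B = if A = B then 1 else 0 := by
  have h : ∀ y : Fin 0 → A.rep, sampleQuotient p 0 ⟨A, y⟩ = A := by
    intro y
    refine (isoClass_quotient_eq_iff _ _ _).2 ⟨?_⟩
    have : Subgroup.closure (Set.range y) = ⊥ := by simp
    exact (QuotientGroup.quotientMulEquivOfEq this).trans QuotientGroup.quotientBot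
  simp only [quotientProb, h, pow_zero, div_one]
  split_ifs with hAB <;> simp [hAB]

/-- The law of the quotient by `u` random elements, with unnormalized masses. -/
theorem tsum_mass_mul_quotientProb (hp : p.Prime) (u v : ℕ) (B : IsoClass p) :
    ∑' A : IsoClass p, mass v A * quotientProb u A B =
      (∏ i ∈ Finset.range u, eulerFactor p (v + i)) * mass (v + u) B := by
  induction u generalizing v with
  | zero =>
    classical
    simp_rw [quotientProb_zero]
    rw [tsum_eq_single B fun A hA => by simp [hA]]
    simp
  | succ u ih =>
    have key : ∀ A : IsoClass p, mass v A * quotientProb (u + 1) A B =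
        ∑' C : IsoClass p, (mass v A * ((Nat.card A.rep : ℝ≥0∞)⁻¹ *
          Nat.card {g : A.rep // isoClass (A.rep.quotient (Subgroup.zpowers g)) = C})) *
          quotientProb u C B := by
      intro A
      rw [quotientProb_succ, ← tsum_card_fiber_mul
        (fun g : A.rep => isoClass (A.rep.quotient (Subgroup.zpowers g)))
        fun C => quotientProb u C B, ← ENNReal.tsum_mul_left, ← ENNReal.tsum_mul_left]
      exact tsum_congr fun C => by ring
    simp_rw [key]
    rw [ENNReal.tsum_comm]
    simp_rw [ENNReal.tsum_mul_right, tsum_mass_mul_card_elements hp, mul_assoc]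
    -- The first generator contributes the factor at `i = 0` and raises `v` by one; the remaining
    -- `u` generators give the shifted product.
    rw [ENNReal.tsum_mul_left, ih (v + 1), Finset.prod_range_succ']
    simp only [add_zero, add_right_comm v 1, ← add_assoc]
    ring

/-! ### The total mass. -/

/-- The class of the trivial group. -/
def trivialClass (p : ℕ) : IsoClass p :=
  isoClass { carrier := Unit, isPGroup := fun _ => ⟨0, rfl⟩ }

theorem eq_trivialClass {A : IsoClass p} (h : Nat.card A.rep = 1) : A = trivialClass p := by
  rw [← isoClass_rep A]
  have := (Nat.card_eq_one_iff_unique.1 h).1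
  let _ : Unique A.rep := ⟨⟨1⟩, fun _ => Subsingleton.elim _ _⟩
  exact (isoClass_eq_iff _ _).2 ⟨{ Equiv.ofUnique (α := A.rep) (β := Unit) with
    map_mul' := fun _ _ => rfl }⟩

theorem mass_trivialClass (v : ℕ) : mass v (trivialClass p) = 1 := by
  obtain ⟨e⟩ := (isoClass_eq_iff _ _).1 (isoClass_rep (trivialClass p))
  have : Subsingleton (trivialClass p).rep := e.toEquiv.subsingleton (β := Unit)
  have h : Nat.card (trivialClass p).rep = 1 := by simp
  have h' : Nat.card (MulAut (trivialClass p).rep) = 1 :=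
    Nat.card_eq_one_iff_unique.2 ⟨⟨fun f g => by ext; exact Subsingleton.elim _ _⟩, ⟨1⟩⟩
  simp [mass, h']

/-- A nontrivial `p`-group has order at least `p`, so all masses but that of the trivial group decay
in `v`. -/
theorem mass_le (hp : p.Prime) (v : ℕ) (A : IsoClass p) [Decidable (A = trivialClass p)] :
    mass v A ≤ (if A = trivialClass p then 1 else 0) + ((p : ℝ≥0∞) ^ v)⁻¹ * mass 0 A := by
  split_ifs with h
  · rw [h, mass_trivialClass]
    exact le_self_add
  · have := Fact.mk hp
    obtain ⟨k, hk⟩ := IsPGroup.iff_card.1 A.rep.isPGroup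
    have hle : p ≤ Nat.card A.rep := by
      rw [hk]
      refine Nat.le_self_pow ?_ p
      rintro rfl
      exact h (eq_trivialClass hk)
    have hle' : (p : ℝ≥0∞) ≤ Nat.card A.rep := by exact_mod_cast hle
    rw [zero_add, mass, mass, pow_zero, one_mul,
      ENNReal.mul_inv (Or.inr (by simp)) (Or.inr (natCard_ne_zero _))]
    gcongr

/-- The total unnormalized mass of the groups of order at most `N`. -/
def truncatedMass (p v N : ℕ) : ℝ≥0∞ :=
  ∑' A : {A : IsoClass p // Nat.card A.rep ≤ N}, mass v A.1

/-- A class is determined by a multiplication table on `Fin n` with `n ≤ N`. -/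
theorem finite_card_le (p N : ℕ) : Finite {A : IsoClass p // Nat.card A.rep ≤ N} := by
  let T := Σ n : Fin (N + 1), (Fin n → Fin n → Fin n)
  let e : ∀ A : {A : IsoClass p // Nat.card A.rep ≤ N}, A.1.rep ≃ Fin (Nat.card A.1.rep) :=
    fun A => Finite.equivFin _
  let f : {A : IsoClass p // Nat.card A.rep ≤ N} → T := fun A =>
    ⟨⟨Nat.card A.1.rep, Nat.lt_succ_of_le A.2⟩, fun i j => e A ((e A).symm i * (e A).symm j)⟩
  have key : ∀ x : T, ∀ A, f A = x → ∃ e' : A.1.rep ≃ Fin x.1,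
      ∀ a b, e' (a * b) = x.2 (e' a) (e' b) := by
    rintro _ A rfl
    exact ⟨e A, fun a b => by simp [f]⟩
  refine Finite.of_injective f fun A A' h => Subtype.ext ?_
  obtain ⟨e₁, h₁⟩ := key _ A h
  obtain ⟨e₂, h₂⟩ := key _ A' rfl
  rw [← isoClass_rep A.1, ← isoClass_rep A'.1]
  refine (isoClass_eq_iff _ _).2 ⟨{ e₁.trans e₂.symm with map_mul' := fun a b => ?_ }⟩
  change e₂.symm (e₁ (a * b)) = e₂.symm (e₁ a) * e₂.symm (e₁ b)
  rw [Equiv.symm_apply_eq, h₁, h₂, Equiv.apply_symm_apply, Equiv.apply_symm_apply]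

theorem mass_ne_top (v : ℕ) (A : IsoClass p) : mass v A ≠ ∞ :=
  ENNReal.inv_ne_top.2 (mul_ne_zero (pow_ne_zero _ (natCard_ne_zero _)) (natCard_ne_zero _))

theorem truncatedMass_ne_top (p v N : ℕ) : truncatedMass p v N ≠ ∞ := by
  have := finite_card_le p N
  have := Fintype.ofFinite {A : IsoClass p // Nat.card A.rep ≤ N}
  rw [truncatedMass, tsum_fintype]
  exact ENNReal.sum_ne_top.2 fun A _ => mass_ne_top v A.1

theorem mass_eq_tsum (v : ℕ) (A : IsoClass p) :
    mass v A = ∑' B : IsoClass p, mass v A * ((Nat.card A.rep : ℝ≥0∞)⁻¹ *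
      Nat.card {g : A.rep // isoClass (A.rep.quotient (Subgroup.zpowers g)) = B}) := by
  have h := tsum_card_fiber_mul
    (fun g : A.rep => isoClass (A.rep.quotient (Subgroup.zpowers g))) fun _ => 1
  rw [tsum_const_finite] at h
  simp only [mul_one] at h
  rw [ENNReal.tsum_mul_left, ENNReal.tsum_mul_left, h,
    ENNReal.inv_mul_cancel (natCard_ne_zero _) (by simp), mul_one]

theorem tsum_mass_eq (hp : p.Prime) (v : ℕ) :
    ∑' A : IsoClass p, mass v A = eulerFactor p v * ∑' A : IsoClass p, mass (v + 1) A := by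
  rw [tsum_congr (mass_eq_tsum v), ENNReal.tsum_comm]
  simp_rw [tsum_mass_mul_card_elements hp, ENNReal.tsum_mul_left]

/-- Quotients of groups of order at most `N` again have order at most `N`, so the recursion survives
truncation as an inequality: the sum over `A` is then enlarged to all classes. -/
theorem truncatedMass_le (hp : p.Prime) (v N : ℕ) :
    truncatedMass p v N ≤ eulerFactor p v * truncatedMass p (v + 1) N := by
  rw [truncatedMass, truncatedMass, ← ENNReal.tsum_mul_left]
  have h := fun A : {A : IsoClass p // Nat.card A.rep ≤ N} => mass_eq_tsum v A.1
  rw [tsum_congr h]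
  simp_rw [← tsum_mass_mul_card_elements hp]
  calc _ ≤ ∑' (A : {A : IsoClass p // Nat.card A.rep ≤ N})
        (B : {B : IsoClass p // Nat.card B.rep ≤ N}), mass v A.1 *
          ((Nat.card A.1.rep : ℝ≥0∞)⁻¹ * Nat.card {g : A.1.rep //
            isoClass (A.1.rep.quotient (Subgroup.zpowers g)) = B.1}) := by
        refine ENNReal.tsum_le_tsum fun A => ?_
        refine (tsum_subtype_eq_of_support_subset fun B hB => ?_).ge
        by_contra hN
        refine hB ?_
        have : IsEmpty {g : A.1.rep // isoClass (A.1.rep.quotient (Subgroup.zpowers g)) = B} := by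
          refine ⟨fun ⟨g, hg⟩ => hN ?_⟩
          obtain ⟨e⟩ := (isoClass_quotient_eq_iff _ _ _).1 hg
          have := card_of_quotient_zpowers g e
          refine le_trans ?_ A.2
          rw [this]
          exact Nat.le_mul_of_pos_left _ (orderOf_pos g)
        simp
    _ ≤ _ := by
        rw [ENNReal.tsum_comm]
        refine ENNReal.tsum_le_tsum fun B => ?_
        exact ENNReal.tsum_comp_le_tsum_of_injective Subtype.val_injective
          fun A : IsoClass p => mass v A * ((Nat.card A.rep : ℝ≥0∞)⁻¹ * Nat.card {g : A.rep //
            isoClass (A.rep.quotient (Subgroup.zpowers g)) = B.1})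

/-- The finite product `∏_{i < v} (1 - p^{-(i + 1)})`. -/
def partialProd (p v : ℕ) : ℝ := ∏ i ∈ Finset.range v, (1 - 1 / (p : ℝ) ^ (i + 1))

theorem factor_pos (hp : 1 < p) (i : ℕ) : 0 < 1 - 1 / (p : ℝ) ^ (i + 1) := by
  have hp' : (1 : ℝ) < p := by exact_mod_cast hp
  rw [sub_pos, div_lt_one (by positivity)]
  exact one_lt_pow₀ hp' (by simp)

theorem partialProd_pos (hp : 1 < p) (v : ℕ) : 0 < partialProd p v :=
  Finset.prod_pos fun i _ => factor_pos hp i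

theorem eulerFactor_eq (hp : 1 < p) (v : ℕ) :
    eulerFactor p v = (ENNReal.ofReal (1 - 1 / (p : ℝ) ^ (v + 1)))⁻¹ := by
  have hp' : (0 : ℝ) < p := by exact_mod_cast (zero_lt_one.trans hp)
  rw [eulerFactor, ENNReal.ofReal_sub _ (by positivity), one_div,
    ENNReal.ofReal_inv_of_pos (by positivity), ENNReal.ofReal_pow hp'.le, ENNReal.ofReal_natCast,
    ENNReal.ofReal_one]

theorem prod_eulerFactor (hp : 1 < p) (v : ℕ) :
    ENNReal.ofReal (partialProd p v) * ∏ i ∈ Finset.range v, eulerFactor p i = 1 := by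
  rw [partialProd, ENNReal.ofReal_prod_of_nonneg fun i _ => (factor_pos hp i).le,
    ← Finset.prod_mul_distrib]
  refine Finset.prod_eq_one fun i _ => ?_
  rw [eulerFactor_eq hp, ENNReal.mul_inv_cancel (by simpa using factor_pos hp i) (by simp)]

theorem tsum_mass_zero (hp : p.Prime) (v : ℕ) :
    ENNReal.ofReal (partialProd p v) * ∑' A : IsoClass p, mass 0 A =
      ∑' A : IsoClass p, mass v A := by
  have h : ∑' A : IsoClass p, mass 0 A =
      (∏ i ∈ Finset.range v, eulerFactor p i) * ∑' A : IsoClass p, mass v A := by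
    induction v with
    | zero => simp
    | succ v ih => rw [ih, tsum_mass_eq hp v, Finset.prod_range_succ, mul_assoc]
  rw [h, ← mul_assoc, prod_eulerFactor hp.one_lt, one_mul]

theorem truncatedMass_zero (hp : p.Prime) (v N : ℕ) :
    ENNReal.ofReal (partialProd p v) * truncatedMass p 0 N ≤ truncatedMass p v N := by
  have h : truncatedMass p 0 N ≤
      (∏ i ∈ Finset.range v, eulerFactor p i) * truncatedMass p v N := by
    induction v with
    | zero => simp
    | succ v ih =>
      refine ih.trans ?_
      rw [Finset.prod_range_succ, mul_assoc]
      gcongr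
      exact truncatedMass_le hp v N
  refine (mul_le_mul_right h _).trans ?_
  rw [← mul_assoc, prod_eulerFactor hp.one_lt, one_mul]

theorem truncatedMass_le_one_add (hp : p.Prime) (v N : ℕ) :
    truncatedMass p v N ≤ 1 + ((p : ℝ≥0∞) ^ v)⁻¹ * truncatedMass p 0 N := by
  classical
  rw [truncatedMass, truncatedMass, ← ENNReal.tsum_mul_left]
  have h := fun A : {A : IsoClass p // Nat.card A.rep ≤ N} => mass_le hp v A.1
  refine (ENNReal.tsum_le_tsum h).trans ?_
  rw [ENNReal.tsum_add]
  gcongr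
  refine (ENNReal.tsum_comp_le_tsum_of_injective Subtype.val_injective
    fun A : IsoClass p => if A = trivialClass p then (1 : ℝ≥0∞) else 0).trans ?_
  rw [tsum_ite_eq]

theorem half_le_partialProd (hp : 3 ≤ p) (v : ℕ) : 1 / 2 ≤ partialProd p v := by
  have hp' : (3 : ℝ) ≤ p := by exact_mod_cast hp
  have hp0 : (0 : ℝ) < p := by linarith
  -- The bound `1 / 2` alone is not inductive. With `x = p ^ (-v)` and `q = 1 / p`, the step reduces
  -- to `x (1 - 2q - xq) ≥ 0`, which follows from `x ≤ 1` and `q ≤ 1 / 3`; this is where `p ≥ 3`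
  -- enters.
  suffices h : 1 / 2 + 1 / 2 * ((p : ℝ) ^ v)⁻¹ ≤ partialProd p v from
    le_trans (by simp) h
  induction v with
  | zero => norm_num [partialProd]
  | succ v ih =>
    rw [partialProd, Finset.prod_range_succ, ← partialProd]
    have hx0 : 0 ≤ ((p : ℝ) ^ v)⁻¹ := by positivity
    have hx1 : ((p : ℝ) ^ v)⁻¹ ≤ 1 := inv_le_one_of_one_le₀ (one_le_pow₀ (by linarith))
    have hq0 : 0 ≤ (p : ℝ)⁻¹ := by positivity
    have hq : (p : ℝ)⁻¹ ≤ 1 / 3 := by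
      rw [one_div]
      exact inv_anti₀ (by norm_num) hp'
    refine le_trans ?_ (mul_le_mul_of_nonneg_right ih (factor_pos (by omega) v).le)
    rw [one_div (_ ^ (v + 1)), pow_succ, mul_inv]
    set x := ((p : ℝ) ^ v)⁻¹
    set q := (p : ℝ)⁻¹
    nlinarith [mul_nonneg hx0 (sub_nonneg.2 hq),
      mul_nonneg (mul_nonneg hx0 hq0) (sub_nonneg.2 hx1)]

/-- The infinite product `∏_{k ≥ 1} (1 - p^{-k-u})`. -/
def tailProd (p u : ℕ) : ℝ := ∏' k : ℕ, (1 - 1 / (p : ℝ) ^ (k + 1 + u))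

theorem tendsto_partialProd (hp : 1 < p) :
    Tendsto (partialProd p) atTop (𝓝 (tailProd p 0)) :=
  (multipliable_weight hp 0).hasProd.tendsto_prod_nat

theorem tailProd_zero_pos (hp : 3 ≤ p) : 0 < tailProd p 0 :=
  one_half_pos.trans_le (ge_of_tendsto' (tendsto_partialProd (by omega)) (half_le_partialProd hp))

theorem partialProd_mul_tailProd (hp : 1 < p) (u : ℕ) :
    partialProd p u * tailProd p u = tailProd p 0 := by
  let f : ℕ → ℝ := fun k => 1 - 1 / (p : ℝ) ^ (k + 1)
  have hf : ∀ k, 1 - 1 / (p : ℝ) ^ (k + 1 + u) = f (k + u) := fun k => by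
    rw [add_right_comm]
  have h : Multipliable fun n : ℕ => f (n + u) := (multipliable_weight hp u).congr hf
  rw [partialProd, tailProd, tprod_congr hf]
  exact h.prod_mul_tprod_nat_mul'

/-- The total unnormalized mass of all groups. -/
theorem tailProd_mul_tsum_mass (hp : p.Prime) (hp3 : 3 ≤ p) :
    ENNReal.ofReal (tailProd p 0) * ∑' A : IsoClass p, mass 0 A = 1 := by
  have hpos := tailProd_zero_pos hp3
  have ht : Tendsto (fun v => ENNReal.ofReal (partialProd p v)) atTop
      (𝓝 (ENNReal.ofReal (tailProd p 0))) :=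
    (ENNReal.continuous_ofReal.tendsto _).comp (tendsto_partialProd hp.one_lt)
  have hne : ENNReal.ofReal (tailProd p 0) ≠ 0 := by simpa using hpos
  refine le_antisymm ?_ ?_
  -- Let `v → ∞` in `partialProd p v * T ≤ 1 + p ^ (-v) * T`, where `T = truncatedMass p 0 N`;
  -- finiteness of `T` makes the last term vanish.
  · have htrunc : ∀ N, ENNReal.ofReal (tailProd p 0) * truncatedMass p 0 N ≤ 1 := by
      intro N
      have h1 := ENNReal.Tendsto.mul_const (b := truncatedMass p 0 N) ht (Or.inl hne)
      have hpow : Tendsto (fun v : ℕ => ((p : ℝ≥0∞) ^ v)⁻¹) atTop (𝓝 0) := by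
        simp_rw [ENNReal.inv_pow]
        exact ENNReal.tendsto_pow_atTop_nhds_zero_of_lt_one
          (ENNReal.inv_lt_one.2 (by exact_mod_cast hp.one_lt))
      have h2 := (ENNReal.Tendsto.mul_const (b := truncatedMass p 0 N) hpow
        (Or.inr (truncatedMass_ne_top p 0 N))).const_add 1
      rw [zero_mul, add_zero] at h2
      exact le_of_tendsto_of_tendsto' h1 h2 fun v =>
        (truncatedMass_zero hp v N).trans (truncatedMass_le_one_add hp v N)
    rw [ENNReal.tsum_eq_iSup_sum, ENNReal.mul_iSup]
    -- Any finite set of classes lies in the truncation at its largest order.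
    refine iSup_le fun s => le_trans ?_ (htrunc (s.sup fun A => Nat.card A.rep))
    gcongr
    have h := ENNReal.tsum_comp_le_tsum_of_injective
      (f := fun A : s => (⟨A.1, Finset.le_sup (f := fun A => Nat.card A.rep) A.2⟩ :
        {A : IsoClass p // Nat.card A.rep ≤ s.sup fun A => Nat.card A.rep}))
      (fun A A' h => Subtype.ext (congrArg (fun x => x.1) h)) (fun A => mass 0 A.1)
    refine le_trans ?_ h
    rw [← Finset.tsum_subtype s (mass 0)]
  -- For every `v` the trivial group alone contributes mass 1. The limit may be taken without
  -- knowing that the sum is finite, because `tailProd p 0` is nonzero.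
  · have h1 := ENNReal.Tendsto.mul_const (b := ∑' A : IsoClass p, mass 0 A) ht (Or.inl hne)
    refine ge_of_tendsto' h1 fun v => ?_
    rw [tsum_mass_zero hp v, ← mass_trivialClass (p := p) v]
    exact ENNReal.le_tsum _

/-! ### From masses to measures. -/

theorem ofReal_weight (u : ℕ) (A : IsoClass p) :
    ENNReal.ofReal (weight u A) = mass u A * ENNReal.ofReal (tailProd p u) := by
  have h : (0 : ℝ) < (Nat.card A.rep : ℝ) ^ u * (Nat.card (MulAut A.rep) : ℝ) := by
    have : (0 : ℝ) < Nat.card A.rep := Nat.cast_pos.2 Nat.card_pos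
    have : (0 : ℝ) < Nat.card (MulAut A.rep) := Nat.cast_pos.2 Nat.card_pos
    positivity
  rw [weight, ENNReal.ofReal_mul (by positivity), one_div, ENNReal.ofReal_inv_of_pos h,
    ENNReal.ofReal_mul (by positivity), ENNReal.ofReal_pow (by positivity),
    ENNReal.ofReal_natCast, ENNReal.ofReal_natCast]
  rfl

theorem clMeasure_apply (u : ℕ) (s : Set (IsoClass p)) :
    clMeasure p u s = ∑' A, ENNReal.ofReal (weight u A) * Measure.dirac A s := by
  rw [clMeasure, Measure.sum_apply _ (MeasurableSet.of_discrete)]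
  simp

theorem isProbabilityMeasure_clMeasure_zero (hp : p.Prime) (hp3 : 3 ≤ p) :
    IsProbabilityMeasure (clMeasure p 0) := by
  refine ⟨?_⟩
  simp_rw [clMeasure_apply, measure_univ, mul_one, ofReal_weight]
  rw [ENNReal.tsum_mul_right, mul_comm, tailProd_mul_tsum_mass hp hp3]

/-- Independent uniform elements of a finite group give each tuple the same probability. -/
theorem pi_uniformOn_apply {G : Type*} [MeasurableSpace G] [DiscreteMeasurableSpace G] [Finite G]
    [Nonempty G] (u : ℕ) (s : Set (Fin u → G)) :
    Measure.pi (fun _ : Fin u => uniformOn (Set.univ : Set G)) s =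
      ((Nat.card G : ℝ≥0∞) ^ u)⁻¹ * ∑' y, Measure.dirac y s := by
  have := Fintype.ofFinite G
  have h : ∀ y : Fin u → G, Measure.pi (fun _ : Fin u => uniformOn (Set.univ : Set G)) {y} =
      ((Nat.card G : ℝ≥0∞) ^ u)⁻¹ := by
    intro y
    rw [Measure.pi_singleton]
    simp [uniformOn_univ, ENNReal.inv_pow]
  conv_lhs => rw [← Measure.sum_smul_dirac (Measure.pi fun _ : Fin u => uniformOn Set.univ),
    Measure.sum_apply _ (MeasurableSet.of_discrete)]
  simp_rw [h, Measure.smul_apply, smul_eq_mul]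
  rw [ENNReal.tsum_mul_left]

theorem map_sampleMeasure_apply (u : ℕ) (s : Set (IsoClass p)) :
    (sampleMeasure p u).map (sampleQuotient p u) s =
      ∑' A : IsoClass p, ENNReal.ofReal (weight 0 A) *
        ∑' B : IsoClass p, quotientProb u A B * Measure.dirac B s := by
  have hs : MeasurableSet s := MeasurableSet.of_discrete
  rw [Measure.map_apply (measurable_sampleQuotient p u) hs, sampleMeasure,
    Measure.bind_apply (measurable_sampleQuotient p u hs) (Measurable.of_discrete).aemeasurable,
    clMeasure, lintegral_sum_measure]
  refine tsum_congr fun A => ?_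
  rw [lintegral_smul_measure, lintegral_dirac, smul_eq_mul,
    Measure.map_apply Measurable.of_discrete (measurable_sampleQuotient p u hs),
    pi_uniformOn_apply]
  congr 1
  have h : ∀ B : IsoClass p, quotientProb u A B * Measure.dirac B s =
      ((Nat.card A.rep : ℝ≥0∞) ^ u)⁻¹ *
        (Nat.card {y : Fin u → A.rep // sampleQuotient p u ⟨A, y⟩ = B} * Measure.dirac B s) :=
    fun B => by rw [quotientProb, div_eq_mul_inv, mul_right_comm, mul_comm]
  rw [tsum_congr h, ENNReal.tsum_mul_left,
    tsum_card_fiber_mul (fun y : Fin u → A.rep => sampleQuotient p u ⟨A, y⟩)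
      fun B => Measure.dirac B s]
  congr 1
  refine tsum_congr fun y => ?_
  rw [Measure.dirac_apply' _ MeasurableSet.of_discrete, Measure.dirac_apply' _ hs]
  rfl

theorem map_sampleMeasure (hp : p.Prime) (u : ℕ) :
    (sampleMeasure p u).map (sampleQuotient p u) = clMeasure p u := by
  ext s _
  rw [map_sampleMeasure_apply, clMeasure_apply]
  simp_rw [← ENNReal.tsum_mul_left]
  rw [ENNReal.tsum_comm]
  refine tsum_congr fun B => ?_
  simp_rw [← mul_assoc]
  rw [ENNReal.tsum_mul_right]
  congr 1
  simp_rw [ofReal_weight, mul_right_comm]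
  -- The first `u` factors of `tailProd p 0` cancel the Euler factors and leave `tailProd p u`.
  rw [ENNReal.tsum_mul_right, tsum_mass_mul_quotientProb hp,
    ← partialProd_mul_tailProd hp.one_lt u, ENNReal.ofReal_mul (partialProd_pos hp.one_lt u).le]
  simp only [zero_add]
  calc _ = (ENNReal.ofReal (partialProd p u) * ∏ i ∈ Finset.range u, eulerFactor p i) *
        (mass u B * ENNReal.ofReal (tailProd p u)) := by ring
    _ = _ := by rw [prod_eulerFactor hp.one_lt, one_mul]

end CohenLenstra

end

theorem proposition2p2 (p : ℕ) (hp : p.Prime) (hp2 : p ≠ 2) (u : ℕ) :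
    IsProbabilityMeasure (CohenLenstra.clMeasure p 0) ∧
      (CohenLenstra.sampleMeasure p u).map (CohenLenstra.sampleQuotient p u) =
        CohenLenstra.clMeasure p u :=
  ⟨CohenLenstra.isProbabilityMeasure_clMeasure_zero hp (by have := hp.two_le; omega),
    CohenLenstra.map_sampleMeasure hp u⟩
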